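/- Let $\{|n\rangle\}_{n\in\mathbb N}$ be the Fock basis of the single-mode Hilbert space $\ell^2(\mathbb N,\mathbb C)$, with creation and annihilation operators $\hat a^\dagger|n\rangle=\sqrt{n+1}\,|n+1\rangle$, $\hat a|n\rangle=\sqrt n\,|n-1\rangle$ (and $\hat a|0\rangle=0$), and for $\alpha\in\mathbb C$ let $|\alpha\rangle=e^{-|\alpha|^2/2}\sum_{n\ge0}\frac{\alpha^n}{\sqrt{n!}}|n\rangle$ be the coherent state and $\hat D(\alpha)=e^{\alpha\hat a^\dagger-\alpha^*\hat a}$ the displacement operator. For a unit vector $|\psi\rangle$, the approximate coherent state rank $\kappa(\psi)\in\mathbb N\cup\{\infty\}$ is the smallest $k$ such that for every $\varepsilon>0$ there are $c_1,\dots,c_k,\alpha_1,\dots,\alpha_k\in\mathbb C$ for which $|\phi_\varepsilon\rangle=\sum_{j=1}^kc_j|\alpha_j\rangle$ is a unit vector with $|\langle\psi|\phi_\varepsilon\rangle|^2\ge1-\varepsilon$. A core state with highest Fock number $m$ is a unit vector $\sum_{i=0}^{m}x_i|i\rangle$ with $x_m\neq0$. Theorem. Let $|\psi\rangle=\sum_{n\ge0}\psi_n|n\rangle$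 be a single-mode pure state (unit vector) and let $r>0$ be an integer. The following are equivalent: (i) $\kappa(\psi)=r$; (ii) the sequence $s_n=\sqrt{n!}\,\psi_n$ follows a linear recurrence relation of order $r$: there are $a_0,\dots,a_{r-1}\in\mathbb C$ with $s_{n+r}=\sum_{i=0}^{r-1}a_is_{n+i}$ for all $n\ge0$, and no relation of this form holds with $r$ replaced by a smaller non-negative integer; (iii) $|\psi\rangle=\sum_{j=1}^kc_j\,\hat D(\alpha_j)|C_j\rangle$ for some $k$, non-zero $c_j\in\mathbb C$, pairwise distinct $\alpha_j\in\mathbb C$ and core states $|C_j\rangle$ with highest Fock numbers $n_j$ satisfying $\sum_{j=1}^k(n_j+1)=r$. -/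

import Mathlib

open scoped Nat ComplexConjugate

namespace Bosonic

noncomputable section

/-- The single-mode Hilbert space: square-summable families of Fock amplitudes. A vector `ψ`
has the amplitude `ψ n` on the Fock state `|n⟩`; a pure state is a vector of norm one. -/
abbrev FockSpace : Type := lp (fun _ : ℕ => ℂ) 2

/-- The Fock state `|n⟩`. -/
def fock (n : ℕ) : FockSpace := lp.single 2 n (1 : ℂ)

/-- The Fock amplitudes `e^{-|α|²/2} αⁿ / √(n!)` of the coherent state `|α⟩`. -/
def coherentAmplitude (α : ℂ) (n : ℕ) : ℂ :=
  Complex.exp (-((‖α‖ ^ 2 / 2 : ℝ) : ℂ)) * (α ^ n / ((√(n ! : ℝ) : ℝ) : ℂ))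

theorem memℓp_coherentAmplitude (α : ℂ) :
    Memℓp (E := fun _ : ℕ => ℂ) (coherentAmplitude α) 2 := by
  apply memℓp_gen
  have h := (Real.summable_pow_div_factorial (‖α‖ ^ 2)).mul_left
    (‖Complex.exp (-((‖α‖ ^ 2 / 2 : ℝ) : ℂ))‖ ^ 2)
  refine h.congr fun n => ?_
  have h2 : (2 : ENNReal).toReal = ((2 : ℕ) : ℝ) := by norm_num
  rw [h2, Real.rpow_natCast, coherentAmplitude, norm_mul, norm_div, norm_pow, Complex.norm_real,
    Real.norm_of_nonneg (Real.sqrt_nonneg _), mul_pow, div_pow, Real.sq_sqrt (by positivity),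
    ← pow_mul, ← pow_mul, mul_comm 2 n]

/-- The coherent state `|α⟩ = e^{-|α|²/2} ∑ₙ αⁿ / √(n!) |n⟩`. -/
def coherent (α : ℂ) : FockSpace := ⟨coherentAmplitude α, memℓp_coherentAmplitude α⟩

/-- The fidelity `|⟨ψ|χ⟩|²` of two pure states. -/
def fidelity (ψ χ : FockSpace) : ℝ := ‖inner ℂ ψ χ‖ ^ 2

/-- For every `ε > 0` some state that is a superposition of `k` coherent states has fidelity at
least `1 - ε` with `ψ`. -/
def ApproximableByCoherent (ψ : FockSpace) (k : ℕ) : Prop :=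
  ∀ ε : ℝ, 0 < ε → ∃ c α : Fin k → ℂ,
    ‖∑ j, c j • coherent (α j)‖ = 1 ∧ 1 - ε ≤ fidelity ψ (∑ j, c j • coherent (α j))

/-- The approximate coherent state rank `κ(ψ)`: the smallest `k` such that `ψ` is approximable
to arbitrary precision by superpositions of `k` coherent states (`⊤` if there is none). -/
def approxCoherentRank (ψ : FockSpace) : ℕ∞ :=
  ⨅ (k : ℕ) (_ : ApproximableByCoherent ψ k), (k : ℕ∞)

/-- The sequence `s` satisfies a homogeneous linear recurrence with constant coefficients
`s (n + d) = ∑ i < d, aᵢ s (n + i)`, for all `n`, of order `d = r` and of no smaller order. -/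
def FollowsRecurrenceOfOrder (s : ℕ → ℂ) (r : ℕ) : Prop :=
  IsLeast {d : ℕ | ∃ E : LinearRecurrence ℂ, E.order = d ∧ E.IsSolution s} r

/-- Finite linear combinations of Fock states, given by their finitely many amplitudes. -/
abbrev CoreVector : Type := ℕ →₀ ℂ

/-- A core vector as an element of the Hilbert space: `C ↦ ∑ₙ C n |n⟩`. -/
def toFock : CoreVector →ₗ[ℂ] FockSpace := Finsupp.linearCombination ℂ fock

/-- The creation operator `a†|n⟩ = √(n+1) |n+1⟩` on core vectors. -/
def creation : CoreVector →ₗ[ℂ] CoreVector :=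
  Finsupp.linearCombination ℂ fun n => Finsupp.single (n + 1) ((√(n + 1 : ℝ) : ℝ) : ℂ)

/-- The annihilation operator `a|n⟩ = √n |n-1⟩`, `a|0⟩ = 0`, on core vectors. -/
def annihilation : CoreVector →ₗ[ℂ] CoreVector :=
  Finsupp.linearCombination ℂ fun n => Finsupp.single (n - 1) ((√(n : ℝ) : ℝ) : ℂ)

/-- The generator `α a† - α* a` of the displacement operator. -/
def displacementGenerator (α : ℂ) : CoreVector →ₗ[ℂ] CoreVector :=
  α • creation - conj α • annihilation

/-- The displacement operator `D(α) = exp (α a† - α* a)` applied to a core vector `C`: the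
exponential series `∑ₘ (1/m!) (α a† - α* a)ᵐ C`. The series converges in norm by
`summable_displace`. -/
def displace (α : ℂ) (C : CoreVector) : FockSpace :=
  ∑' m : ℕ, ((m ! : ℂ)⁻¹) • toFock ((displacementGenerator α ^ m) C)

/-- `C` is a core state (a normalized finite superposition of Fock states) with highest Fock
number `n`. -/
def IsCoreState (C : CoreVector) (n : ℕ) : Prop :=
  ‖toFock C‖ = 1 ∧ C n ≠ 0 ∧ ∀ m, n < m → C m = 0

/-- `ψ = ∑_{j=1}^k c_j D(α_j)|C_j⟩` with non-zero coefficients, distinct displacement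
amplitudes, and core states `C_j` of highest Fock number `n_j`, where `∑ (n_j + 1) = r`. -/
def IsDisplacedCoreSuperposition (ψ : FockSpace) (r : ℕ) : Prop :=
  ∃ (k : ℕ) (c α : Fin k → ℂ) (C : Fin k → CoreVector) (n : Fin k → ℕ),
    (∀ j, c j ≠ 0) ∧ Function.Injective α ∧ (∀ j, IsCoreState (C j) (n j)) ∧
    ∑ j, (n j + 1) = r ∧ ψ = ∑ j, c j • displace (α j) (C j)

theorem displacementGenerator_single (α : ℂ) (n : ℕ) :
    displacementGenerator α (Finsupp.single n 1) =
      (α * ((√(n + 1 : ℝ) : ℝ) : ℂ)) • Finsupp.single (n + 1) (1 : ℂ) -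
      (conj α * ((√(n : ℝ) : ℝ) : ℂ)) • Finsupp.single (n - 1) (1 : ℂ) := by
  simp [displacementGenerator, creation, annihilation, Finsupp.linearCombination_single]

theorem norm_generator_pow_single (α : ℂ) (m : ℕ) : ∀ n : ℕ,
    ‖toFock ((displacementGenerator α ^ m) (Finsupp.single n 1))‖ ≤
      (2 * ‖α‖) ^ m * √((n + m)! / n ! : ℝ) := by
  induction m with
  | zero =>
    intro n
    have h : ‖fock n‖ = 1 := by
      rw [fock, lp.norm_single (by norm_num)]; simp
    have h2 : (n ! : ℝ) ≠ 0 := by positivity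
    simp [toFock, Finsupp.linearCombination_single, h, h2]
  | succ m ih =>
    intro n
    rw [pow_succ, Module.End.mul_apply, displacementGenerator_single, map_sub, map_sub, map_smul,
      map_smul, map_smul, map_smul]
    refine (norm_sub_le _ _).trans ?_
    rw [norm_smul, norm_smul, norm_mul, norm_mul, RCLike.norm_conj, Complex.norm_real,
      Complex.norm_real, Real.norm_of_nonneg (Real.sqrt_nonneg _),
      Real.norm_of_nonneg (Real.sqrt_nonneg _)]
    have key1 : √(n + 1 : ℝ) * √((n + 1 + m)! / (n + 1)! : ℝ) = √((n + (m + 1))! / n ! : ℝ) := by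
      rw [← Real.sqrt_mul (by positivity), show n + 1 + m = n + (m + 1) by ring,
        Nat.factorial_succ n]
      congr 1
      push_cast
      have h2 : (n ! : ℝ) ≠ 0 := by positivity
      have h3 : (n + 1 : ℝ) ≠ 0 := by positivity
      field_simp
    have key2 : √(n : ℝ) * √((n - 1 + m)! / (n - 1)! : ℝ) ≤ √((n + (m + 1))! / n ! : ℝ) := by
      rcases n with _ | n
      · simp
      · rw [← Real.sqrt_mul (by positivity)]
        apply Real.sqrt_le_sqrt
        have e : n + 1 + (m + 1) = (n + m) + 1 + 1 := by ring
        rw [e, Nat.add_sub_cancel, Nat.factorial_succ (n + m + 1), Nat.factorial_succ (n + m),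
          Nat.factorial_succ n]
        push_cast
        have h2 : (0 : ℝ) < n ! := by positivity
        have h3 : (0 : ℝ) < (n + 1 : ℝ) := by positivity
        have h4 : (0 : ℝ) < (n + m)! := by positivity
        rw [le_div_iff₀ (by positivity)]
        have : ((n : ℝ) + 1) * ((n + m)! / n !) * ((n + 1) * n !) =
            (n + 1) * (n + 1) * (n + m)! := by field_simp
        rw [this, ← mul_assoc]
        apply mul_le_mul_of_nonneg_right _ h4.le
        have hn : (0 : ℝ) ≤ n := by positivity
        have hm : (0 : ℝ) ≤ m := by positivity
        nlinarith [mul_nonneg hn hm]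
    calc ‖α‖ * √(n + 1 : ℝ) *
          ‖toFock ((displacementGenerator α ^ m) (Finsupp.single (n + 1) 1))‖ +
        ‖α‖ * √(n : ℝ) * ‖toFock ((displacementGenerator α ^ m) (Finsupp.single (n - 1) 1))‖
        ≤ ‖α‖ * √(n + 1 : ℝ) * ((2 * ‖α‖) ^ m * √((n + 1 + m)! / (n + 1)! : ℝ)) +
          ‖α‖ * √(n : ℝ) * ((2 * ‖α‖) ^ m * √((n - 1 + m)! / (n - 1)! : ℝ)) := by
          gcongr
          · exact ih _
          · exact ih _
      _ = ‖α‖ * (2 * ‖α‖) ^ m * (√(n + 1 : ℝ) * √((n + 1 + m)! / (n + 1)! : ℝ)) +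
          ‖α‖ * (2 * ‖α‖) ^ m * (√(n : ℝ) * √((n - 1 + m)! / (n - 1)! : ℝ)) := by ring
      _ ≤ ‖α‖ * (2 * ‖α‖) ^ m * √((n + (m + 1))! / n ! : ℝ) +
          ‖α‖ * (2 * ‖α‖) ^ m * √((n + (m + 1))! / n ! : ℝ) := by
          rw [key1]; gcongr
      _ = (2 * ‖α‖) ^ (m + 1) * √((n + (m + 1))! / n ! : ℝ) := by ring

/-- The exponential series of the displacement operator converges on every core vector. -/
theorem summable_displace (α : ℂ) (C : CoreVector) :
    Summable fun m : ℕ => ((m ! : ℂ)⁻¹) • toFock ((displacementGenerator α ^ m) C) := by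
  induction C using Finsupp.induction_linear with
  | zero => simp
  | add f g hf hg =>
    refine (hf.add hg).congr fun m => ?_
    rw [map_add, map_add, smul_add]
  | single n z =>
    have hz : Finsupp.single n z = z • Finsupp.single n (1 : ℂ) := by simp
    suffices h : Summable fun m : ℕ =>
        ((m ! : ℂ)⁻¹) • toFock ((displacementGenerator α ^ m) (Finsupp.single n 1)) by
      refine (h.const_smul z).congr fun m => ?_
      rw [hz, map_smul, map_smul, smul_comm]
    apply Summable.of_norm_bounded
      (g := fun m : ℕ => (2 * (2 * ‖α‖) ^ 2 * 2) ^ m / m ! + 2 ^ n * (1 / 2 : ℝ) ^ m)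
    · exact (Real.summable_pow_div_factorial _).add
        ((summable_geometric_of_lt_one (by norm_num) (by norm_num)).mul_left _)
    · intro m
      rw [norm_smul, norm_inv, Complex.norm_natCast]
      refine (mul_le_mul_of_nonneg_left (norm_generator_pow_single α m n)
        (by positivity)).trans ?_
      have hm : (0 : ℝ) < m ! := by positivity
      have hn : (0 : ℝ) < n ! := by positivity
      have hc : ((n + m)! / n ! : ℝ) = (n + m).choose n * m ! := by
        rw [div_eq_iff hn.ne']
        have := Nat.add_choose_mul_factorial_mul_factorial n m
        rw [← this, Nat.choose_symm_add]; push_cast; ring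
      have hch : ((n + m).choose n : ℝ) ≤ 2 ^ n * 2 ^ m := by
        rw [← pow_add]; exact_mod_cast Nat.choose_le_two_pow _ _
      set x : ℝ := (2 * ‖α‖) ^ m with hx
      have hxx : (2 * (2 * ‖α‖) ^ 2 * 2) ^ m = x ^ 2 * 4 ^ m := by
        rw [hx, ← pow_mul, mul_comm m 2, pow_mul, ← mul_pow]; ring
      have hx0 : 0 ≤ x := by positivity
      have hA : 0 ≤ x ^ 2 * 4 ^ m / m ! + 2 ^ n * (1 / 2 : ℝ) ^ m := by positivity
      rw [hxx]
      have hs : (m ! : ℝ)⁻¹ * (x * √((n + m)! / n ! : ℝ)) =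
          √(x ^ 2 * ((n + m).choose n) / m !) := by
        rw [eq_comm, Real.sqrt_eq_iff_mul_self_eq (by positivity) (by positivity)]
        rw [show ∀ a b c : ℝ, a * (b * c) * (a * (b * c)) = a ^ 2 * b ^ 2 * (c * c) by
          intros; ring, Real.mul_self_sqrt (by positivity), hc]
        field_simp
      rw [hs]
      apply Real.sqrt_le_iff.mpr ⟨hA, ?_⟩
      have e1 : x ^ 2 * ((n + m).choose n) / m ! ≤ x ^ 2 * (2 ^ n * 2 ^ m) / m ! := by gcongr
      have e2 : x ^ 2 * (2 ^ n * 2 ^ m) / m ! =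
          (x ^ 2 * 4 ^ m / m !) * (2 ^ n * (1 / 2 : ℝ) ^ m) := by
        have : (4 : ℝ) ^ m * (1 / 2) ^ m = 2 ^ m := by rw [← mul_pow]; norm_num
        rw [← this]; ring
      rw [e2] at e1
      refine e1.trans ?_
      have p : 0 ≤ x ^ 2 * 4 ^ m / m ! := by positivity
      have q : (0 : ℝ) ≤ 2 ^ n * (1 / 2 : ℝ) ^ m := by positivity
      nlinarith [mul_nonneg p q]

end

end Bosonic

namespace Bosonic

noncomputable section

open Polynomial Filter Topology

/-! Write T for the shift and s for the sequence √(n!) ψₙ. A recurrence of order d for s is a monic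
polynomial p of degree d with p(T) s = 0, and a coherent state has geometric s, an eigenvector of T.
Both equivalences thus become statements about polynomials that annihilate s.

Approximability by k coherent states is the same as a recurrence of order k. A superposition of k
coherent states is annihilated by ∏ (T - αⱼ). Along superpositions of fidelity tending to 1, the
coefficient vectors of these polynomials, scaled to norm one, have a limit point, and it annihilates
s (`obeysRecurrence_of_approximable`). Conversely, given a recurrence, its characteristic roots are
perturbed to distinct ones, and a Vandermonde system gives combinations of geometric sequences with
the same first k terms as s. They converge to s termwise under a uniform geometric bound, hence in
norm because of the weights 1/n! (`approximable_of_obeysRecurrence`).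

For displaced core states, a D(α) = D(α)(a + α) makes T - α act on the amplitudes of D(α)|C⟩ as the
annihilation operator acts on C. A highest Fock number n therefore means a generalized eigenvector
of T of exact order n + 1, and all generalized eigenvectors arise so
(`exists_displacedAmplitude_eq`). Primary decomposition of s under T then matches the minimal order
with ∑ (nⱼ + 1). -/

/-! ### Recurrences as annihilating polynomials of the shift. -/

/-- The left shift on sequences. -/
def shift : (ℕ → ℂ) →ₗ[ℂ] (ℕ → ℂ) := LinearMap.funLeft ℂ ℂ Nat.succ

@[simp] theorem shift_apply (s : ℕ → ℂ) (n : ℕ) : shift s n = s (n + 1) := rfl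

theorem shift_pow_apply (i : ℕ) : ∀ (s : ℕ → ℂ) (n : ℕ), (shift ^ i) s n = s (n + i) := by
  induction i with
  | zero => intro s n; simp
  | succ i ih =>
    intro s n
    rw [pow_succ, Module.End.mul_apply, ih, shift_apply, add_assoc]

theorem aeval_shift_apply_of_natDegree_lt {p : ℂ[X]} {k : ℕ} (hp : p.natDegree < k) (s : ℕ → ℂ)
    (n : ℕ) : aeval shift p s n = ∑ i : Fin k, p.coeff i * s (n + i) := by
  rw [aeval_eq_sum_range' hp, LinearMap.sum_apply, Finset.sum_apply, Finset.sum_range]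
  simp [shift_pow_apply]

theorem aeval_shift_apply_of_monic {p : ℂ[X]} (hp : p.Monic) {d : ℕ} (hd : p.natDegree = d)
    (s : ℕ → ℂ) (n : ℕ) :
    aeval shift p s n = (∑ i : Fin d, p.coeff i * s (n + i)) + s (n + d) := by
  rw [aeval_shift_apply_of_natDegree_lt (k := d + 1) (by omega), Fin.sum_univ_castSucc]
  have : p.coeff d = 1 := by rw [← hd]; exact hp
  simp [this]

/-- A sequence obeys some linear recurrence of order `d`. -/
def ObeysRecurrence (s : ℕ → ℂ) (d : ℕ) : Prop :=
  ∃ E : LinearRecurrence ℂ, E.order = d ∧ E.IsSolution s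

theorem obeysRecurrence_iff_exists_monic {s : ℕ → ℂ} {d : ℕ} :
    ObeysRecurrence s d ↔ ∃ p : ℂ[X], p.Monic ∧ p.natDegree = d ∧ aeval shift p s = 0 := by
  constructor
  · rintro ⟨E, rfl, hE⟩
    have hd : E.charPoly.natDegree = E.order :=
      natDegree_eq_of_degree_eq_some E.charPoly_degree_eq_order
    refine ⟨E.charPoly, E.charPoly_monic, hd, funext fun n => ?_⟩
    rw [aeval_shift_apply_of_monic E.charPoly_monic hd, hE n, ← Finset.sum_add_distrib]
    refine Finset.sum_eq_zero fun i _ => ?_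
    have : E.charPoly.coeff i = - E.coeffs i := by
      rw [LinearRecurrence.charPoly, coeff_sub, finsetSum_coeff]
      simp [coeff_monomial, i.2.ne', Fin.val_inj]
    rw [this]; ring
  · rintro ⟨p, hp, hd, h⟩
    refine ⟨⟨d, fun i => - p.coeff i⟩, rfl, fun n => ?_⟩
    have := aeval_shift_apply_of_monic hp hd s n
    rw [h, Pi.zero_apply] at this
    simp only [neg_mul, Finset.sum_neg_distrib]
    linear_combination -this

/-- Dividing by the leading coefficient and multiplying by a power of X raises the degree to exactly
d. This absorbs limits of polynomials whose top coefficient vanishes. -/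
theorem obeysRecurrence_of_aeval_eq_zero {s : ℕ → ℂ} {d : ℕ} {p : ℂ[X]} (hp : p ≠ 0)
    (hd : p.natDegree ≤ d) (h : aeval shift p s = 0) : ObeysRecurrence s d := by
  rw [obeysRecurrence_iff_exists_monic]
  have hm := monic_mul_leadingCoeff_inv hp
  refine ⟨X ^ (d - p.natDegree) * (p * C p.leadingCoeff⁻¹), (monic_X_pow _).mul hm, ?_, ?_⟩
  · rw [(monic_X_pow _).natDegree_mul hm, natDegree_X_pow, natDegree_mul_leadingCoeff_inv p hp]
    omega
  · rw [mul_comm p, ← mul_assoc, map_mul, Module.End.mul_apply, h, map_zero]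

/-! ### Generalized eigenvectors and primary decomposition. -/

theorem aeval_eq_zero_of_isCoprime {M : Type*} [AddCommGroup M] [Module ℂ M] {f : Module.End ℂ M}
    {p q : ℂ[X]} (h : IsCoprime p q) {x : M} (hp : aeval f p x = 0) (hq : aeval f q x = 0) :
    x = 0 := by
  have := (disjoint_ker_aeval_of_isCoprime f h).le_bot
    ⟨LinearMap.mem_ker.2 hp, LinearMap.mem_ker.2 hq⟩
  simpa using this

theorem isCoprime_prod_X_sub_C_pow {ι : Type*} {α : ι → ℂ} (hα : Function.Injective α)
    (m : ι → ℕ) {j : ι} {S : Finset ι} (hj : j ∉ S) :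
    IsCoprime ((X - C (α j)) ^ m j) (∏ l ∈ S, (X - C (α l)) ^ m l) := by
  refine IsCoprime.prod_right fun l hl => IsCoprime.pow ?_
  exact pairwise_coprime_X_sub_C hα (fun e => hj (e ▸ hl))

/-- If the root a had multiplicity e ≤ n in q, the cofactor, being prime to X - a, would act
injectively on the kernel of (X - a)^(n+1), so (X - a)^e would already kill x. -/
theorem X_sub_C_pow_dvd_of_aeval_eq_zero {M : Type*} [AddCommGroup M] [Module ℂ M]
    {f : Module.End ℂ M} {q : ℂ[X]} (hq : q ≠ 0) {a : ℂ} {n : ℕ} {x : M}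
    (h : aeval f q x = 0) (hx : aeval f ((X - C a) ^ (n + 1)) x = 0)
    (hx' : aeval f ((X - C a) ^ n) x ≠ 0) : (X - C a) ^ (n + 1) ∣ q := by
  by_contra hdvd
  obtain ⟨u, hu, hcop⟩ := exists_eq_pow_rootMultiplicity_mul_and_not_dvd q hq a
  set e := q.rootMultiplicity a with he
  have hen : e ≤ n := by
    by_contra hlt
    exact hdvd ((pow_dvd_pow _ (by omega)).trans ⟨u, hu⟩)
  have hcop' : IsCoprime ((X - C a) ^ (n + 1)) u :=
    IsCoprime.pow_left (((prime_X_sub_C a).irreducible.coprime_iff_not_dvd).2 hcop)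
  have h0 : aeval f ((X - C a) ^ e) x = 0 := by
    apply aeval_eq_zero_of_isCoprime hcop'
    · rw [← Module.End.mul_apply, ← map_mul, mul_comm, map_mul, Module.End.mul_apply, hx, map_zero]
    · rw [← Module.End.mul_apply, ← map_mul, mul_comm, ← hu, h]
  apply hx'
  rw [show n = (n - e) + e by omega, pow_add, map_mul, Module.End.mul_apply, h0, map_zero]

/-- The annihilator of a sum of generalized eigenvectors for distinct eigenvalues is divisible by
the product of the annihilators of the summands. -/
theorem prod_X_sub_C_pow_dvd {ι : Type*} [Fintype ι] {M : Type*} [AddCommGroup M] [Module ℂ M]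
    {f : Module.End ℂ M} {α : ι → ℂ} (hα : Function.Injective α) (n : ι → ℕ) {x : ι → M}
    (hx : ∀ j, aeval f ((X - C (α j)) ^ (n j + 1)) (x j) = 0)
    (hx' : ∀ j, aeval f ((X - C (α j)) ^ n j) (x j) ≠ 0) {q : ℂ[X]} (hq : q ≠ 0)
    (h : aeval f q (∑ j, x j) = 0) : ∏ j, (X - C (α j)) ^ (n j + 1) ∣ q := by
  classical
  refine Finset.prod_dvd_of_coprime (fun i _ j _ hij => IsCoprime.pow
    (pairwise_coprime_X_sub_C hα hij)) fun j _ => ?_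
  refine X_sub_C_pow_dvd_of_aeval_eq_zero hq ?_ (hx j) (hx' j)
  -- P kills every summand but `x j`, so P q kills `x j`. Since P is coprime to the annihilator of
  -- `x j`, q alone must kill it.
  set P : ℂ[X] := ∏ l ∈ Finset.univ.erase j, (X - C (α l)) ^ (n l + 1) with hP
  have hcop : IsCoprime ((X - C (α j)) ^ (n j + 1)) P :=
    isCoprime_prod_X_sub_C_pow hα (fun j => n j + 1) (Finset.notMem_erase _ _)
  have hPl : ∀ l, l ≠ j → aeval f P (x l) = 0 := by
    intro l hl
    rw [hP, ← Finset.prod_erase_mul _ _ (Finset.mem_erase.2 ⟨hl, Finset.mem_univ l⟩), map_mul,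
      Module.End.mul_apply, hx l, map_zero]
  have comm : ∀ (a b : ℂ[X]) (y : M), aeval f a (aeval f b y) = aeval f b (aeval f a y) := by
    intro a b y
    rw [← Module.End.mul_apply, ← map_mul, mul_comm, map_mul, Module.End.mul_apply]
  apply aeval_eq_zero_of_isCoprime hcop
  · rw [comm, hx j, map_zero]
  · have h1 : aeval f P (∑ l, x l) = aeval f P (x j) := by
      rw [map_sum]
      exact Finset.sum_eq_single j (fun l _ hl => hPl l hl) (by simp)
    rw [comm, ← h1, comm, h, map_zero]

/-- Primary decomposition of a vector annihilated by a product of powers of linear factors. -/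
theorem exists_sum_eq_of_aeval_prod_eq_zero {ι : Type*} {M : Type*} [AddCommGroup M]
    [Module ℂ M] {f : Module.End ℂ M} {α : ι → ℂ} (hα : Function.Injective α) (m : ι → ℕ)
    (S : Finset ι) : ∀ y : M, aeval f (∏ j ∈ S, (X - C (α j)) ^ m j) y = 0 →
    ∃ x : ι → M, (∀ j ∈ S, aeval f ((X - C (α j)) ^ m j) (x j) = 0) ∧ y = ∑ j ∈ S, x j := by
  classical
  induction S using Finset.induction_on with
  | empty => intro y hy; exact ⟨0, by simp, by simpa using hy⟩
  | insert j S hj ih =>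
    intro y hy
    rw [Finset.prod_insert hj, ← LinearMap.mem_ker, ← sup_ker_aeval_eq_ker_aeval_mul_of_coprime f
      (isCoprime_prod_X_sub_C_pow hα m hj), Submodule.mem_sup] at hy
    obtain ⟨u, hu, v, hv, rfl⟩ := hy
    obtain ⟨x, hx, rfl⟩ := ih v hv
    refine ⟨Function.update x j u, fun l hl => ?_, ?_⟩
    · rcases eq_or_ne l j with rfl | hlj
      · simpa using hu
      · rw [Function.update_of_ne hlj]
        exact hx l ((Finset.mem_insert.1 hl).resolve_left hlj)
    · rw [Finset.sum_insert hj, Function.update_self]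
      congr 1
      refine Finset.sum_congr rfl fun l hl => ?_
      rw [Function.update_of_ne (by rintro rfl; exact hj hl)]

/-! ### Rescaled amplitudes of coherent superpositions. -/

/-- The sequence `√(n!) ψₙ` of a state. -/
def rescaledAmplitude : FockSpace →ₗ[ℂ] (ℕ → ℂ) where
  toFun ψ n := ((√(n ! : ℝ) : ℝ) : ℂ) * ψ n
  map_add' ψ χ := by ext n; simp [mul_add]
  map_smul' c ψ := by ext n; simp; ring

theorem rescaledAmplitude_apply (ψ : FockSpace) (n : ℕ) :
    rescaledAmplitude ψ n = ((√(n ! : ℝ) : ℝ) : ℂ) * ψ n := rfl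

theorem sqrt_factorial_ne_zero (n : ℕ) : ((√(n ! : ℝ) : ℝ) : ℂ) ≠ 0 := by
  have : (0 : ℝ) < n ! := by positivity
  exact_mod_cast (Real.sqrt_pos.2 this).ne'

theorem rescaledAmplitude_injective : Function.Injective rescaledAmplitude := by
  intro ψ χ h
  ext n
  exact mul_left_cancel₀ (sqrt_factorial_ne_zero n) (congrFun h n)

theorem rescaledAmplitude_coherent (α : ℂ) (n : ℕ) :
    rescaledAmplitude (coherent α) n = Complex.exp (-((‖α‖ ^ 2 / 2 : ℝ) : ℂ)) * α ^ n := by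
  have := sqrt_factorial_ne_zero n
  rw [rescaledAmplitude_apply, coherent]
  change _ * coherentAmplitude α n = _
  rw [coherentAmplitude]
  field_simp

theorem aeval_shift_sum_geom {k : ℕ} (α c : Fin k → ℂ) :
    aeval shift (∏ j, (X - C (α j))) (fun n => ∑ j, c j * α j ^ n) = 0 := by
  have h : (fun n => ∑ j, c j * α j ^ n) = ∑ j, c j • (fun n => α j ^ n : ℕ → ℂ) := by
    ext n; simp
  rw [h, map_sum]
  refine Finset.sum_eq_zero fun j hj => ?_
  rw [map_smul, ← Finset.prod_erase_mul _ _ hj, map_mul, Module.End.mul_apply]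
  have : aeval shift (X - C (α j)) (fun n => α j ^ n : ℕ → ℂ) = 0 := by
    ext n
    simp [pow_succ']
  rw [this, map_zero, smul_zero]

/-! ### From approximability to a recurrence. -/

/-- Fidelity ignores the global phase, so it controls the distance to the line spanned by ψ and not
to ψ itself. -/
theorem norm_sub_inner_smul_sq {ψ χ : FockSpace} (hψ : ‖ψ‖ = 1) (hχ : ‖χ‖ = 1) :
    ‖χ - inner ℂ ψ χ • ψ‖ ^ 2 = 1 - fidelity ψ χ := by
  have h := @norm_sub_sq ℂ FockSpace _ _ _ χ (inner ℂ ψ χ • ψ)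
  rw [h, inner_smul_right, norm_smul, hψ, hχ, fidelity, ← inner_conj_symm χ ψ,
    Complex.mul_conj, Complex.normSq_eq_norm_sq]
  simp only [RCLike.re_to_complex, Complex.ofReal_re]
  ring

theorem aeval_shift_superposition {k : ℕ} (c α : Fin k → ℂ) :
    aeval shift (∏ j, (X - C (α j))) (rescaledAmplitude (∑ j, c j • coherent (α j))) = 0 := by
  rw [← aeval_shift_sum_geom α fun j => c j * Complex.exp (-((‖α j‖ ^ 2 / 2 : ℝ) : ℂ))]
  congr 1
  ext n
  simp only [map_sum, map_smul, Finset.sum_apply, Pi.smul_apply, smul_eq_mul,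
    rescaledAmplitude_coherent, mul_assoc]

/-- Unit norm replaces monicity because the αⱼ may run off to infinity along an approximating
sequence; the unit sphere is compact. -/
theorem exists_norm_eq_one_relation {k : ℕ} (c α : Fin k → ℂ) :
    ∃ u : Fin (k + 1) → ℂ, ‖u‖ = 1 ∧
      ∀ n, ∑ i, u i * rescaledAmplitude (∑ j, c j • coherent (α j)) (n + i) = 0 := by
  set q : ℂ[X] := ∏ j, (X - C (α j)) with hq
  have hd : q.natDegree = k := by
    rw [hq, natDegree_prod_of_monic _ _ fun j _ => monic_X_sub_C _]; simp
  have hm : q.Monic := monic_prod_of_monic _ _ fun j _ => monic_X_sub_C _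
  set v : Fin (k + 1) → ℂ := fun i => q.coeff i with hv
  have hv0 : v ≠ 0 := by
    intro h
    have := congrFun h (Fin.last k)
    have h1 : q.coeff k = 1 := by rw [← hd]; exact hm
    simp [hv, h1] at this
  refine ⟨((‖v‖⁻¹ : ℝ) : ℂ) • v, ?_, fun n => ?_⟩
  · rw [norm_smul, Complex.norm_real, norm_inv, norm_norm, inv_mul_cancel₀ (norm_ne_zero_iff.2 hv0)]
  · have h := congrFun (aeval_shift_superposition c α) n
    rw [aeval_shift_apply_of_natDegree_lt (k := k + 1) (hd.trans_lt k.lt_succ_self)] at h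
    simp only [Pi.smul_apply, smul_eq_mul, mul_assoc, ← Finset.mul_sum]
    rw [hv, h]; simp

theorem obeysRecurrence_of_approximable {ψ : FockSpace} (hψ : ‖ψ‖ = 1) {k : ℕ}
    (h : ApproximableByCoherent ψ k) : ObeysRecurrence (rescaledAmplitude ψ) k := by
  choose c α hnorm hfid using fun m : ℕ => h (1 / ((m : ℝ) + 1)) (by positivity)
  choose u hu hrel using fun m => exists_norm_eq_one_relation (c m) (α m)
  set χ : ℕ → FockSpace := fun m => ∑ j, c m j • coherent (α m j) with hχ
  obtain ⟨w, hw, f, hf, hlim⟩ := (isCompact_sphere (0 : Fin (k + 1) → ℂ) 1).tendsto_subseq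
    (x := u) (fun m => by simp [hu m])
  set z : ℕ → ℂ := fun m => inner ℂ ψ (χ m) with hz
  have hε : Tendsto (fun m : ℕ => 1 / ((m : ℝ) + 1)) atTop (𝓝 0) :=
    tendsto_one_div_add_atTop_nhds_zero_nat
  have hdist : Tendsto (fun m => χ m - z m • ψ) atTop (𝓝 0) := by
    rw [tendsto_zero_iff_norm_tendsto_zero]
    have h2 : Tendsto (fun m => ‖χ m - z m • ψ‖ ^ 2) atTop (𝓝 0) := by
      refine squeeze_zero (fun m => by positivity) (fun m => ?_) hε
      rw [norm_sub_inner_smul_sq hψ (hnorm m)]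
      linarith [hfid m]
    have h3 := h2.sqrt
    simpa [Real.sqrt_sq (norm_nonneg _)] using h3
  have hzn : ∀ m, ‖z m‖ ≤ 1 := fun m => by
    have := norm_inner_le_norm (𝕜 := ℂ) ψ (χ m)
    rwa [hψ, hnorm m, one_mul] at this
  have hz2 : Tendsto (fun m => ‖z m‖ ^ 2) atTop (𝓝 1) := by
    refine tendsto_of_tendsto_of_tendsto_of_le_of_le (g := fun m : ℕ => 1 - 1 / ((m : ℝ) + 1))
      (h := fun _ => 1) (by simpa using hε.const_sub 1) tendsto_const_nhds (fun m => hfid m)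
      fun m => pow_le_one₀ (norm_nonneg _) (hzn m)
  set s := rescaledAmplitude ψ with hs
  have hcoord : ∀ n, Tendsto (fun m => rescaledAmplitude (χ m - z m • ψ) n) atTop (𝓝 0) := by
    intro n
    have h1 := ((lp.evalCLM ℂ (fun _ : ℕ => ℂ) 2 n).continuous.tendsto 0).comp hdist
    rw [map_zero] at h1
    have h2 := h1.const_mul ((√(n ! : ℝ) : ℝ) : ℂ)
    rwa [mul_zero] at h2
  have hkey : ∀ n, ∑ i, w i * s (n + i) = 0 := by
    intro n
    have hwi : ∀ i, Tendsto (fun m => u (f m) i) atTop (𝓝 (w i)) := fun i =>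
      (tendsto_pi_nhds.1 hlim) i
    have hW : Tendsto (fun m => ∑ i, u (f m) i * s (n + i)) atTop (𝓝 (∑ i, w i * s (n + i))) :=
      tendsto_finsetSum _ fun i _ => (hwi i).mul_const _
    -- The relation annihilates χ, so on zψ it equals minus its value on χ - zψ, which tends to 0 in
    -- each coordinate.
    have hzW : Tendsto (fun m => z (f m) * ∑ i, u (f m) i * s (n + i)) atTop (𝓝 0) := by
      have h1 : Tendsto (fun m => -∑ i, u (f m) i *
          rescaledAmplitude (χ (f m) - z (f m) • ψ) (n + i)) atTop
          (𝓝 (-∑ i : Fin (k + 1), w i * 0)) :=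
        (tendsto_finsetSum _ fun i _ => (hwi i).mul ((hcoord (n + i)).comp hf.tendsto_atTop)).neg
      simp only [mul_zero, Finset.sum_const_zero, neg_zero] at h1
      refine h1.congr fun m => ?_
      have h2 := hrel (f m) n
      simp only [map_sub, map_smul, Pi.sub_apply, Pi.smul_apply, smul_eq_mul, mul_sub,
        Finset.sum_sub_distrib]
      rw [h2, Finset.mul_sum, zero_sub, neg_neg]
      exact Finset.sum_congr rfl fun i _ => by ring
    -- Only |z| → 1 is known, as z may have no limit, so the factor z is removed by comparing
    -- absolute values.
    have h2 : Tendsto (fun m => ‖z (f m)‖ ^ 2 * ‖∑ i, u (f m) i * s (n + i)‖) atTop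
        (𝓝 (1 * ‖∑ i, w i * s (n + i)‖)) := (hz2.comp hf.tendsto_atTop).mul hW.norm
    have h3 : Tendsto (fun m => ‖z (f m)‖ ^ 2 * ‖∑ i, u (f m) i * s (n + i)‖) atTop (𝓝 0) := by
      refine squeeze_zero (fun m => by positivity) (fun m => ?_) (by simpa using hzW.norm)
      rw [pow_two, mul_assoc]
      calc ‖z (f m)‖ * (‖z (f m)‖ * ‖∑ i, u (f m) i * s (n + i)‖)
          ≤ 1 * (‖z (f m)‖ * ‖∑ i, u (f m) i * s (n + i)‖) := by gcongr; exact hzn _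
        _ = _ := by simp
    have := tendsto_nhds_unique h2 h3
    simpa using this
  set p : ℂ[X] := ∑ i : Fin (k + 1), monomial (i : ℕ) (w i) with hp
  have hcoeff : ∀ i : Fin (k + 1), p.coeff i = w i := by
    intro i
    rw [hp, finsetSum_coeff]
    simp [coeff_monomial, Fin.val_inj]
  have hdeg : p.natDegree ≤ k := natDegree_sum_le_of_forall_le _ _ fun i _ =>
    (natDegree_monomial_le _).trans (by omega)
  -- The limit w has norm one, so p ≠ 0, but its degree may drop below k.
  refine obeysRecurrence_of_aeval_eq_zero (p := p) ?_ hdeg ?_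
  · intro h0
    have : w = 0 := funext fun i => by rw [← hcoeff i, h0]; simp
    rw [this] at hw
    simp at hw
  · ext n
    rw [aeval_shift_apply_of_natDegree_lt (k := k + 1) (by omega), Pi.zero_apply, ← hkey n]
    simp only [hcoeff]

/-! ### From a recurrence to approximability. -/

theorem tendsto_coeff_prod_X_sub_C {ι β : Type*} {l : Filter β} (S : Finset ι) {a : ι → β → ℂ}
    {b : ι → ℂ} (h : ∀ j ∈ S, Tendsto (a j) l (𝓝 (b j))) (i : ℕ) :
    Tendsto (fun x => (∏ j ∈ S, (X - C (a j x))).coeff i) l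
      (𝓝 ((∏ j ∈ S, (X - C (b j))).coeff i)) := by
  classical
  induction S using Finset.induction_on generalizing i with
  | empty => simpa using tendsto_const_nhds
  | insert j S hj ih =>
    simp only [Finset.prod_insert hj, sub_mul, coeff_sub, coeff_C_mul]
    have hS := ih fun l hl => h l (Finset.mem_insert_of_mem hl)
    refine Tendsto.sub ?_ ((h j (Finset.mem_insert_self _ _)).mul (hS i))
    cases i with
    | zero => simpa using tendsto_const_nhds
    | succ i => simpa [coeff_X_mul] using hS i

/-- Equal roots separate as soon as t ≠ 0, and distinct roots stay distinct for small t. -/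
theorem eventually_injective_perturbation {k : ℕ} (α : Fin k → ℂ) :
    ∀ᶠ t : ℂ in 𝓝[≠] 0, Function.Injective fun j : Fin k => α j + t * (j : ℕ) := by
  have h : ∀ p : Fin k × Fin k, ∀ᶠ t : ℂ in 𝓝[≠] 0, p.1 ≠ p.2 →
      α p.1 + t * (p.1 : ℕ) ≠ α p.2 + t * (p.2 : ℕ) := by
    rintro ⟨i, j⟩
    by_cases hij : i = j
    · exact Eventually.of_forall fun t h => absurd hij h
    have hne : ((i : ℕ) : ℂ) - ((j : ℕ) : ℂ) ≠ 0 := by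
      rw [sub_ne_zero]; exact_mod_cast fun h => hij (Fin.ext h)
    by_cases hα : α i = α j
    · filter_upwards [self_mem_nhdsWithin] with t ht _ h
      apply ht
      simp only [hα, add_right_inj] at h
      have : t * (((i : ℕ) : ℂ) - ((j : ℕ) : ℂ)) = 0 := by linear_combination h
      exact (mul_eq_zero.1 this).resolve_right hne
    · have hc : Tendsto (fun t : ℂ => (α i + t * (i : ℕ)) - (α j + t * (j : ℕ))) (𝓝[≠] 0)
          (𝓝 (α i - α j)) := by
        have : Continuous fun t : ℂ => (α i + t * (i : ℕ)) - (α j + t * (j : ℕ)) := by fun_prop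
        simpa using (this.tendsto 0).mono_left nhdsWithin_le_nhds
      filter_upwards [hc.eventually_ne (sub_ne_zero.2 hα)] with t ht _ using sub_ne_zero.1 ht
  filter_upwards [eventually_all.2 h] with t ht i j hij
  by_contra hne
  exact ht (i, j) hne hij

theorem exists_sum_geom_eq {k : ℕ} {β : Fin k → ℂ} (hβ : Function.Injective β) (s : ℕ → ℂ) :
    ∃ c : Fin k → ℂ, ∀ i : ℕ, i < k → ∑ j, c j * β j ^ i = s i := by
  have hdet : IsUnit (Matrix.vandermonde β).det :=
    isUnit_iff_ne_zero.2 (Matrix.det_vandermonde_ne_zero_iff.2 hβ)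
  have hu : IsUnit (Matrix.vandermonde β) := (Matrix.isUnit_iff_isUnit_det _).2 hdet
  obtain ⟨c, hc⟩ := (Matrix.vecMul_surjective_iff_isUnit.2 hu) fun i : Fin k => s i
  refine ⟨c, fun i hi => ?_⟩
  have := congrFun hc ⟨i, hi⟩
  simpa [Matrix.vecMul, dotProduct, Matrix.vandermonde_apply] using this

/-- The bound depends only on the initial values and the size of the coefficients, so it is uniform
over nearby recurrences. `1 ≤ M` makes M ^ n monotone in n. -/
theorem norm_le_of_recurrence {k : ℕ} {a : Fin k → ℂ} {t : ℕ → ℂ} {B M : ℝ} (hM : 1 ≤ M)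
    (ha : ∑ i, ‖a i‖ ≤ M) (h0 : ∀ n < k, ‖t n‖ ≤ B)
    (hB : 0 ≤ B) (h : ∀ n, t (n + k) = ∑ i, a i * t (n + i)) (n : ℕ) : ‖t n‖ ≤ B * M ^ n := by
  induction n using Nat.strong_induction_on with
  | _ n ih =>
    by_cases hn : n < k
    · exact (h0 n hn).trans (le_mul_of_one_le_right hB (one_le_pow₀ hM))
    obtain ⟨n, rfl⟩ := Nat.exists_eq_add_of_le' (not_lt.1 hn)
    rw [h n]
    calc ‖∑ i, a i * t (n + i)‖ ≤ ∑ i, ‖a i‖ * (B * M ^ (n + k - 1)) := by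
          refine norm_sum_le_of_le _ fun i _ => ?_
          rw [norm_mul]
          gcongr
          refine (ih (n + i) (by omega)).trans ?_
          gcongr
          omega
      _ = (∑ i, ‖a i‖) * (B * M ^ (n + k - 1)) := by rw [Finset.sum_mul]
      _ ≤ B * M ^ (n + k) := by
          -- When n + k = 0 the exponent n + k - 1 truncates, but then k = 0 and the sum is empty.
          rcases Nat.eq_zero_or_pos (n + k) with h0 | h0
          · have : k = 0 := by omega
            subst this
            simp; positivity
          · calc (∑ i, ‖a i‖) * (B * M ^ (n + k - 1)) ≤ M * (B * M ^ (n + k - 1)) := by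
                  gcongr
              _ = B * M ^ (n + k - 1 + 1) := by ring
              _ = B * M ^ (n + k) := by rw [Nat.sub_add_cancel h0]

theorem norm_sq_eq_tsum_rescaledAmplitude (χ : FockSpace) :
    ‖χ‖ ^ 2 = ∑' n, ‖rescaledAmplitude χ n‖ ^ 2 / n ! := by
  have h := lp.norm_rpow_eq_tsum (p := 2) (by norm_num) χ
  have h2 : (2 : ENNReal).toReal = ((2 : ℕ) : ℝ) := by norm_num
  simp only [h2, Real.rpow_natCast] at h
  rw [h]
  refine tsum_congr fun n => ?_
  have hn : (0 : ℝ) < n ! := by positivity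
  rw [rescaledAmplitude_apply, norm_mul, Complex.norm_real, Real.norm_of_nonneg (Real.sqrt_nonneg _),
    mul_pow, Real.sq_sqrt hn.le]
  field_simp

/-- Dominated convergence for ‖χ‖² = ∑ |sₙ|²/n!, with the summable majorant B² M²ⁿ/n!. -/
theorem tendsto_of_rescaledAmplitude {β : Type*} {l : Filter β} [l.IsCountablyGenerated]
    {χ : β → FockSpace}
    {ψ : FockSpace} {B M : ℝ} (hb : ∀ᶠ x in l, ∀ n, ‖rescaledAmplitude (χ x - ψ) n‖ ≤ B * M ^ n)
    (h : ∀ n, Tendsto (fun x => rescaledAmplitude (χ x) n) l (𝓝 (rescaledAmplitude ψ n))) :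
    Tendsto χ l (𝓝 ψ) := by
  rw [tendsto_iff_norm_sub_tendsto_zero]
  have h2 : Tendsto (fun x => ‖χ x - ψ‖ ^ 2) l (𝓝 0) := by
    simp only [norm_sq_eq_tsum_rescaledAmplitude]
    have h0 : (0 : ℝ) = ∑' n : ℕ, (0 : ℝ) := by simp
    rw [h0]
    refine tendsto_tsum_of_dominated_convergence
      (bound := fun n => B ^ 2 * ((M ^ 2) ^ n / n !))
      ((Real.summable_pow_div_factorial _).mul_left _) (fun n => ?_) ?_
    · have h1 : Tendsto (fun x => rescaledAmplitude (χ x - ψ) n) l (𝓝 0) := by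
        simpa using (h n).sub_const (rescaledAmplitude ψ n)
      simpa using (h1.norm.pow 2).div_const (n ! : ℝ)
    · filter_upwards [hb] with x hx n
      rw [Real.norm_of_nonneg (by positivity), ← mul_div_assoc]
      gcongr
      calc _ ≤ (B * M ^ n) ^ 2 := by gcongr; exact hx n
        _ = _ := by ring
  simpa [Real.sqrt_sq (norm_nonneg _)] using h2.sqrt

theorem approximable_of_tendsto {β : Type*} {l : Filter β} [l.NeBot] {ψ : FockSpace}
    (hψ : ‖ψ‖ = 1) {k : ℕ} {c α : β → Fin k → ℂ}
    (h : Tendsto (fun x => ∑ j, c x j • coherent (α x j)) l (𝓝 ψ)) :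
    ApproximableByCoherent ψ k := by
  intro ε hε
  set χ := fun x => ∑ j, c x j • coherent (α x j) with hχ
  have hn : Tendsto (fun x => ‖χ x‖) l (𝓝 1) := hψ ▸ h.norm
  have hunit : Tendsto (fun x => ((‖χ x‖⁻¹ : ℝ) : ℂ) • χ x) l (𝓝 ψ) := by
    have h1 : Tendsto (fun x => ((‖χ x‖⁻¹ : ℝ) : ℂ)) l (𝓝 ((1⁻¹ : ℝ) : ℂ)) :=
      (Complex.continuous_ofReal.tendsto _).comp (hn.inv₀ one_ne_zero)
    simpa using h1.smul h
  have hf : Tendsto (fun x => fidelity ψ (((‖χ x‖⁻¹ : ℝ) : ℂ) • χ x)) l (𝓝 1) := by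
    have h1 := ((tendsto_const_nhds (x := ψ)).inner (𝕜 := ℂ) hunit).norm.pow 2
    have h2 : ‖inner ℂ ψ ψ‖ ^ 2 = 1 := by simp [inner_self_eq_norm_sq_to_K, hψ]
    rwa [h2] at h1
  obtain ⟨x, hx1, hx2⟩ := ((hf.eventually (lt_mem_nhds (show 1 - ε < 1 by linarith))).and
    (hn.eventually_ne one_ne_zero)).exists
  have e : ∑ j, (((‖χ x‖⁻¹ : ℝ) : ℂ) * c x j) • coherent (α x j) = ((‖χ x‖⁻¹ : ℝ) : ℂ) • χ x := by
    rw [hχ, Finset.smul_sum]; simp only [mul_smul]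
  refine ⟨fun j => ((‖χ x‖⁻¹ : ℝ) : ℂ) * c x j, α x, ?_, ?_⟩
  · rw [e, norm_smul, Complex.norm_real, norm_inv, norm_norm, inv_mul_cancel₀ hx2]
  · rw [e]; exact hx1.le

theorem approximable_of_obeysRecurrence {ψ : FockSpace} (hψ : ‖ψ‖ = 1) {k : ℕ}
    (h : ObeysRecurrence (rescaledAmplitude ψ) k) : ApproximableByCoherent ψ k := by
  obtain ⟨p, hp, hd, hs⟩ := obeysRecurrence_iff_exists_monic.1 h
  set s := rescaledAmplitude ψ with hsdef
  have hsplit : p.Splits := IsAlgClosed.splits p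
  obtain ⟨α, hα⟩ : ∃ α : Fin k → ℂ, p = ∏ j, (X - C (α j)) := by
    have hcard : p.roots.toList.length = k := by
      rw [Multiset.length_toList, ← hd]; exact hsplit.natDegree_eq_card_roots.symm
    subst hcard
    refine ⟨fun j => p.roots.toList.get j, ?_⟩
    conv_lhs => rw [hsplit.eq_prod_roots_of_monic hp, ← Multiset.coe_toList p.roots]
    rw [Multiset.map_coe, Multiset.prod_coe, ← List.prod_ofFn]
    congr 1
    apply List.ext_get <;> simp
  set α' : ℂ → Fin k → ℂ := fun t j => α j + t * (j : ℕ) with hα'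
  have hc : ∀ t, ∃ c : Fin k → ℂ, Function.Injective (α' t) →
      ∀ i : ℕ, i < k → ∑ j, c j * α' t j ^ i = s i := by
    intro t
    by_cases ht : Function.Injective (α' t)
    · obtain ⟨c, hc⟩ := exists_sum_geom_eq ht s
      exact ⟨c, fun _ => hc⟩
    · exact ⟨0, fun h => absurd h ht⟩
  choose c hc using hc
  set q : ℂ → ℂ[X] := fun t => ∏ j, (X - C (α' t j)) with hq
  set S : ℂ → ℕ → ℂ := fun t n => ∑ j, c t j * α' t j ^ n with hS
  have monic_prod : ∀ β : Fin k → ℂ, (∏ j, (X - C (β j))).Monic := fun β =>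
    monic_prod_of_monic _ _ fun j _ => monic_X_sub_C _
  have deg_prod : ∀ β : Fin k → ℂ, (∏ j, (X - C (β j))).natDegree = k := fun β => by
    rw [natDegree_prod_of_monic _ _ fun j _ => monic_X_sub_C _]; simp
  have hSrec : ∀ t n, S t (n + k) = ∑ i : Fin k, -(q t).coeff i * S t (n + i) := by
    intro t n
    have h1 := aeval_shift_apply_of_monic (monic_prod (α' t)) (deg_prod _) (S t) n
    rw [aeval_shift_sum_geom (α' t) (c t), Pi.zero_apply] at h1
    simp only [neg_mul, Finset.sum_neg_distrib]
    linear_combination -h1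
  have hsrec : ∀ n, s (n + k) = ∑ i : Fin k, -p.coeff i * s (n + i) := by
    intro n
    have h1 := aeval_shift_apply_of_monic hp hd s n
    rw [hs, Pi.zero_apply] at h1
    simp only [neg_mul, Finset.sum_neg_distrib]
    linear_combination -h1
  have hqlim : ∀ i, Tendsto (fun t => (q t).coeff i) (𝓝[≠] 0) (𝓝 (p.coeff i)) := by
    intro i
    rw [hα]
    refine tendsto_coeff_prod_X_sub_C _ (a := fun j t => α' t j) (fun j _ => ?_) i
    have : Continuous fun t : ℂ => α j + t * (j : ℕ) := by fun_prop
    simpa using (this.tendsto 0).mono_left nhdsWithin_le_nhds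
  have hinj : ∀ᶠ t in 𝓝[≠] (0 : ℂ), Function.Injective (α' t) :=
    eventually_injective_perturbation α
  have hlim : ∀ n, Tendsto (fun t => S t n) (𝓝[≠] 0) (𝓝 (s n)) := by
    intro n
    induction n using Nat.strong_induction_on with
    | _ n ih =>
      by_cases hn : n < k
      · refine tendsto_const_nhds.congr' ?_
        filter_upwards [hinj] with t ht using (hc t ht n hn).symm
      obtain ⟨n, rfl⟩ := Nat.exists_eq_add_of_le' (not_lt.1 hn)
      rw [hsrec n]
      simp only [hSrec]
      exact tendsto_finsetSum _ fun i _ => (hqlim i).neg.mul (ih _ (by omega))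
  set B : ℝ := ∑ n ∈ Finset.range k, ‖s n‖ with hBdef
  have hB : ∀ n < k, ‖s n‖ ≤ B := fun n hn =>
    Finset.single_le_sum (f := fun n => ‖s n‖) (fun _ _ => norm_nonneg _) (Finset.mem_range.2 hn)
  have hB0 : 0 ≤ B := Finset.sum_nonneg fun _ _ => norm_nonneg _
  -- The extra 1 gives `1 ≤ M` and leaves strict room for the perturbed coefficients.
  set M : ℝ := (∑ i : Fin k, ‖-p.coeff i‖) + 1 with hM
  have hM1 : 1 ≤ M := le_add_of_nonneg_left (Finset.sum_nonneg fun _ _ => norm_nonneg _)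
  have hbs := norm_le_of_recurrence hM1 (by linarith) hB hB0 hsrec
  have hbS : ∀ᶠ t in 𝓝[≠] (0 : ℂ), ∀ n, ‖S t n‖ ≤ B * M ^ n := by
    have h1 : Tendsto (fun t => ∑ i : Fin k, ‖-(q t).coeff i‖) (𝓝[≠] 0)
        (𝓝 (∑ i : Fin k, ‖-p.coeff i‖)) :=
      tendsto_finsetSum _ fun i _ => (hqlim i).neg.norm
    filter_upwards [hinj, h1.eventually (gt_mem_nhds (show _ < M by rw [hM]; linarith))]
      with t ht1 ht2
    exact norm_le_of_recurrence hM1 ht2.le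
      (fun n hn => (congrArg norm (hc t ht1 n hn)).trans_le (hB n hn)) hB0 (hSrec t)
  set c' : ℂ → Fin k → ℂ := fun t j =>
    c t j * (Complex.exp (-((‖α' t j‖ ^ 2 / 2 : ℝ) : ℂ)))⁻¹ with hc'
  have hamp : ∀ t n, rescaledAmplitude (∑ j, c' t j • coherent (α' t j)) n = S t n := by
    intro t n
    simp only [map_sum, map_smul, Finset.sum_apply, Pi.smul_apply, smul_eq_mul,
      rescaledAmplitude_coherent, hS, hc']
    refine Finset.sum_congr rfl fun j _ => ?_
    rw [mul_assoc, inv_mul_cancel_left₀ (Complex.exp_ne_zero _)]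
  refine approximable_of_tendsto (l := 𝓝[≠] (0 : ℂ)) hψ (c := c') (α := α')
    (tendsto_of_rescaledAmplitude (B := 2 * B) (M := M) ?_ fun n => ?_)
  · filter_upwards [hbS] with t ht n
    rw [map_sub, Pi.sub_apply, hamp]
    refine (norm_sub_le _ _).trans ?_
    linarith [ht n, hbs n]
  · simpa only [hamp] using hlim n

/-! ### Ladder operators and amplitudes of displaced core states. -/

theorem toFock_apply (C : CoreVector) (n : ℕ) : toFock C n = C n := by
  induction C using Finsupp.induction_linear with
  | zero => simp
  | add f g hf hg => simp [hf, hg]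
  | single m z =>
    rw [toFock, Finsupp.linearCombination_single, lp.coeFn_smul, Pi.smul_apply, fock,
      lp.single_apply]
    rcases eq_or_ne n m with rfl | h
    · simp
    · simp [h]

theorem toFock_injective : Function.Injective toFock := by
  intro C D h
  ext n
  rw [← toFock_apply, h, toFock_apply]

theorem annihilation_apply (C : CoreVector) (n : ℕ) :
    annihilation C n = ((√(n + 1 : ℝ) : ℝ) : ℂ) * C (n + 1) := by
  induction C using Finsupp.induction_linear with
  | zero => simp
  | add f g hf hg => simp [hf, hg, mul_add]
  | single m z =>
    rw [annihilation, Finsupp.linearCombination_single]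
    rcases m with _ | m
    · simp
    · rcases eq_or_ne n m with rfl | h
      · simp [mul_comm]
      · simp [h]

theorem creation_single (n : ℕ) : creation (Finsupp.single n 1) =
    ((√(n + 1 : ℝ) : ℝ) : ℂ) • Finsupp.single (n + 1) (1 : ℂ) := by
  simp [creation, Finsupp.linearCombination_single]

theorem annihilation_single (n : ℕ) : annihilation (Finsupp.single n 1) =
    ((√(n : ℝ) : ℝ) : ℂ) • Finsupp.single (n - 1) (1 : ℂ) := by
  simp [annihilation, Finsupp.linearCombination_single]

theorem ofReal_sqrt_mul_self {x : ℝ} (hx : 0 ≤ x) : ((√x : ℝ) : ℂ) * ((√x : ℝ) : ℂ) = x := by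
  rw [← Complex.ofReal_mul, Real.mul_self_sqrt hx]

theorem annihilation_mul_creation : annihilation * creation = creation * annihilation + 1 := by
  refine Finsupp.lhom_ext fun n z => ?_
  have hz : Finsupp.single n z = z • Finsupp.single n (1 : ℂ) := by simp
  rw [hz, map_smul, map_smul]
  congr 1
  rw [Module.End.mul_apply, creation_single, map_smul, annihilation_single, LinearMap.add_apply,
    Module.End.mul_apply, annihilation_single, map_smul, creation_single, smul_smul, smul_smul,
    Module.End.one_apply]
  have h1 := ofReal_sqrt_mul_self (x := (n + 1 : ℝ)) (by positivity)
  rcases n with _ | n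
  · simp
  · have h2 := ofReal_sqrt_mul_self (x := (n + 1 : ℝ)) (by positivity)
    push_cast at h1 h2 ⊢
    rw [h1, h2, add_smul, one_smul]

theorem annihilation_mul_displacementGenerator (α : ℂ) :
    annihilation * displacementGenerator α = displacementGenerator α * annihilation + α • 1 := by
  refine LinearMap.ext fun D => ?_
  have h := LinearMap.congr_fun annihilation_mul_creation D
  simp only [Module.End.mul_apply, LinearMap.add_apply, Module.End.one_apply] at h
  simp only [displacementGenerator, Module.End.mul_apply, LinearMap.add_apply, LinearMap.sub_apply,
    LinearMap.smul_apply, map_sub, map_smul, h, Module.End.one_apply, smul_add]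
  abel

/-- The commutator of a with the generator is the scalar α, so a acts on powers of the generator as
a derivation. -/
theorem annihilation_mul_displacementGenerator_pow (α : ℂ) (m : ℕ) :
    annihilation * displacementGenerator α ^ (m + 1) =
      displacementGenerator α ^ (m + 1) * annihilation +
        ((m + 1 : ℕ) * α : ℂ) • displacementGenerator α ^ m := by
  induction m with
  | zero => simpa using annihilation_mul_displacementGenerator α
  | succ m ih =>
    rw [pow_succ _ (m + 1), ← mul_assoc, ih, add_mul, mul_assoc,
      annihilation_mul_displacementGenerator, mul_add, smul_mul_assoc, ← pow_succ, mul_smul_comm,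
      mul_one, ← mul_assoc, add_assoc, ← add_smul]
    congr 2
    push_cast; ring

/-- The rescaled amplitudes of `D(α)|C⟩`. -/
def displacedAmplitude (α : ℂ) : CoreVector →ₗ[ℂ] (ℕ → ℂ) where
  toFun C := rescaledAmplitude (displace α C)
  map_add' C D := by
    rw [← map_add]
    congr 1
    rw [displace, displace, displace, ← (summable_displace α C).tsum_add (summable_displace α D)]
    simp
  map_smul' z C := by
    rw [RingHom.id_apply, ← map_smul]
    congr 1
    rw [displace, displace, ← (summable_displace α C).tsum_const_smul]
    refine tsum_congr fun m => ?_
    rw [map_smul, map_smul, smul_comm]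

theorem displacedAmplitude_apply (α : ℂ) (C : CoreVector) :
    displacedAmplitude α C = rescaledAmplitude (displace α C) := rfl

theorem hasSum_displacedAmplitude (α : ℂ) (C : CoreVector) (n : ℕ) :
    HasSum (fun m : ℕ => (m ! : ℂ)⁻¹ * (((√(n ! : ℝ) : ℝ) : ℂ) *
      (displacementGenerator α ^ m) C n)) (displacedAmplitude α C n) := by
  have h := ((summable_displace α C).hasSum.mapL
    (lp.evalCLM ℂ (fun _ : ℕ => ℂ) 2 n)).mul_left ((√(n ! : ℝ) : ℝ) : ℂ)
  refine h.congr_fun fun m => ?_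
  change _ = _ * (((m ! : ℂ)⁻¹ • toFock _ : FockSpace) n)
  rw [lp.coeFn_smul, Pi.smul_apply, toFock_apply, smul_eq_mul]
  ring

/-- This is a D(α) = D(α)(a + α) in coordinates, since shifting √(n!) ψₙ amounts to applying a. It
is checked term by term in the exponential series, which avoids applying the unbounded a to the sum.
-/
theorem shift_displacedAmplitude (α : ℂ) (C : CoreVector) :
    shift (displacedAmplitude α C) =
      displacedAmplitude α (annihilation C) + α • displacedAmplitude α C := by
  ext n
  rw [shift_apply, Pi.add_apply, Pi.smul_apply, smul_eq_mul]
  refine (hasSum_displacedAmplitude α C (n + 1)).unique ?_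
  have hstep : ∀ D : CoreVector, ((√((n + 1)! : ℝ) : ℝ) : ℂ) * D (n + 1) =
      ((√(n ! : ℝ) : ℝ) : ℂ) * annihilation D n := by
    intro D
    rw [annihilation_apply, ← mul_assoc, ← Complex.ofReal_mul, ← Real.sqrt_mul (by positivity),
      Nat.factorial_succ]
    push_cast
    rw [mul_comm (n ! : ℝ)]
  have h1 := hasSum_displacedAmplitude α (annihilation C) n
  have h2 := (hasSum_displacedAmplitude α C n).mul_left α
  -- The factor m kills the term m = 0, so the truncated m - 1 is harmless.
  set f : ℕ → ℂ := fun m => (m ! : ℂ)⁻¹ * (m * α * (((√(n ! : ℝ) : ℝ) : ℂ) *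
      (displacementGenerator α ^ (m - 1)) C n)) with hf
  have h3 : HasSum f (α * displacedAmplitude α C n) := by
    rw [← hasSum_nat_add_iff' 1]
    simp only [Finset.range_one, Finset.sum_singleton, hf, Nat.cast_zero, zero_mul, mul_zero,
      sub_zero]
    refine h2.congr_fun fun m => ?_
    have hm : (m ! : ℂ) ≠ 0 := by exact_mod_cast m.factorial_ne_zero
    have hm' : (m + 1 : ℂ) ≠ 0 := by exact_mod_cast m.succ_ne_zero
    rw [Nat.factorial_succ, Nat.add_sub_cancel]
    push_cast
    field_simp
  refine (h1.add h3).congr_fun fun m => ?_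
  rw [hstep, ← Module.End.mul_apply, hf]
  rcases m with _ | m
  · simp
  · rw [annihilation_mul_displacementGenerator_pow, LinearMap.add_apply, LinearMap.smul_apply,
      Finsupp.add_apply, Finsupp.smul_apply, Module.End.mul_apply, smul_eq_mul]
    dsimp only
    rw [Nat.add_sub_cancel]
    ring

theorem aeval_X_sub_C_pow_displacedAmplitude (α : ℂ) (m : ℕ) : ∀ D : CoreVector,
    aeval shift ((X - C α) ^ m) (displacedAmplitude α D) =
      displacedAmplitude α ((annihilation ^ m) D) := by
  induction m with
  | zero => simp
  | succ m ih =>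
    intro D
    have h1 : aeval shift (X - C α) (displacedAmplitude α D) =
        displacedAmplitude α (annihilation D) := by
      simp [shift_displacedAmplitude, Module.algebraMap_end_apply]
    rw [pow_succ, map_mul, Module.End.mul_apply, h1, ih, pow_succ, Module.End.mul_apply]

/-- The vacuum component of the generator applied to D is -α* times that of aD. With a|0⟩ = 0 and
the power commutator this gives a two-step recursion in the exponent. -/
theorem displacementGenerator_pow_single_zero_apply_zero (α : ℂ) (l : ℕ) :
    ((displacementGenerator α ^ (2 * l)) (Finsupp.single 0 1) 0 =
      (2 * l)! * ((-(‖α‖ ^ 2 / 2 : ℝ) : ℂ) ^ l / l !)) ∧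
    (displacementGenerator α ^ (2 * l + 1)) (Finsupp.single 0 1) 0 = 0 := by
  have hann : annihilation (Finsupp.single 0 (1 : ℂ)) = 0 := by simp [annihilation_single]
  have hcre : ∀ D : CoreVector, creation D 0 = 0 := by
    intro D
    induction D using Finsupp.induction_linear with
    | zero => simp
    | add f g hf hg => simp [hf, hg]
    | single m z => rw [creation, Finsupp.linearCombination_single]; simp
  have hgen : ∀ D : CoreVector, displacementGenerator α D 0 = -conj α * annihilation D 0 := by
    intro D
    simp [displacementGenerator, hcre]
  have hrec : ∀ m : ℕ, (displacementGenerator α ^ (m + 2)) (Finsupp.single 0 1) 0 =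
      -(‖α‖ ^ 2 : ℝ) * (m + 1) * (displacementGenerator α ^ m) (Finsupp.single 0 1) 0 := by
    intro m
    rw [pow_succ', Module.End.mul_apply, hgen, ← Module.End.mul_apply,
      annihilation_mul_displacementGenerator_pow, LinearMap.add_apply, Module.End.mul_apply, hann,
      LinearMap.map_zero, zero_add, LinearMap.smul_apply, Finsupp.smul_apply, smul_eq_mul,
      ← Complex.normSq_eq_norm_sq, Complex.normSq_eq_conj_mul_self]
    push_cast
    ring
  induction l with
  | zero => simp [hgen, hann]
  | succ l ih =>
    rw [show 2 * (l + 1) = 2 * l + 2 by ring, hrec, show 2 * l + 2 + 1 = (2 * l + 1) + 2 by ring,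
      hrec, ih.1, ih.2]
    refine ⟨?_, by simp⟩
    rw [Nat.factorial_succ, Nat.factorial_succ, Nat.factorial_succ]
    have hm : (l ! : ℂ) ≠ 0 := by exact_mod_cast l.factorial_ne_zero
    have hm' : (l + 1 : ℂ) ≠ 0 := by exact_mod_cast l.succ_ne_zero
    push_cast
    field_simp
    ring

theorem displacedAmplitude_vacuum_zero (α : ℂ) :
    displacedAmplitude α (Finsupp.single 0 1) 0 = Complex.exp (-(‖α‖ ^ 2 / 2 : ℝ)) := by
  refine (hasSum_displacedAmplitude α _ 0).unique ?_
  rw [← add_zero (Complex.exp _)]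
  refine HasSum.even_add_odd ?_ ?_
  · rw [Complex.exp_eq_exp_ℂ]
    refine (NormedSpace.expSeries_div_hasSum_exp _).congr_fun fun l => ?_
    rw [(displacementGenerator_pow_single_zero_apply_zero α l).1]
    have hm : ((2 * l)! : ℂ) ≠ 0 := by exact_mod_cast (2 * l).factorial_ne_zero
    simp [hm]
  · refine hasSum_zero.congr_fun fun l => ?_
    rw [(displacementGenerator_pow_single_zero_apply_zero α l).2]
    simp

/-! ### Displaced core states as generalized eigenvectors of the shift. -/

theorem annihilation_pow_apply_eq_zero {n : ℕ} {C : CoreVector} (hC : ∀ m, n ≤ m → C m = 0) :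
    (annihilation ^ n) C = 0 := by
  induction n generalizing C with
  | zero => ext m; simp [hC m]
  | succ n ih =>
    rw [pow_succ, Module.End.mul_apply]
    refine ih fun m hm => ?_
    rw [annihilation_apply, hC _ (by omega), mul_zero]

/-- The surviving vacuum term shows that the generalized eigenvector has order exactly n + 1. -/
theorem annihilation_pow_apply_eq_single {n : ℕ} {C : CoreVector} (hC : ∀ m, n < m → C m = 0) :
    (annihilation ^ n) C = Finsupp.single 0 (((√(n ! : ℝ) : ℝ) : ℂ) * C n) := by
  induction n generalizing C with
  | zero =>
    ext m
    rcases Nat.eq_zero_or_pos m with rfl | hm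
    · simp
    · simp [hC m hm, hm.ne']
  | succ n ih =>
    rw [pow_succ, Module.End.mul_apply, ih, annihilation_apply, ← mul_assoc, ← Complex.ofReal_mul,
      ← Real.sqrt_mul (by positivity), Nat.factorial_succ]
    · push_cast
      rw [mul_comm (n ! : ℝ)]
    · intro m hm
      rw [annihilation_apply, hC _ (by omega), mul_zero]

theorem displacedAmplitude_single_zero_ne_zero (α : ℂ) {z : ℂ} (hz : z ≠ 0) :
    displacedAmplitude α (Finsupp.single 0 z) ≠ 0 := by
  intro h
  have h1 : Finsupp.single 0 z = z • Finsupp.single 0 (1 : ℂ) := by simp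
  rw [h1, map_smul] at h
  have h2 := congrFun h 0
  rw [Pi.smul_apply, displacedAmplitude_vacuum_zero, Pi.zero_apply] at h2
  exact (smul_ne_zero hz (Complex.exp_ne_zero _)) h2

theorem aeval_displacedAmplitude_eq_zero (α : ℂ) {n : ℕ} {D : CoreVector}
    (hD : ∀ m, n ≤ m → D m = 0) : aeval shift ((X - C α) ^ n) (displacedAmplitude α D) = 0 := by
  rw [aeval_X_sub_C_pow_displacedAmplitude, annihilation_pow_apply_eq_zero hD, map_zero]

theorem aeval_displacedAmplitude_ne_zero (α : ℂ) {n : ℕ} {D : CoreVector} (hn : D n ≠ 0)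
    (hD : ∀ m, n < m → D m = 0) : aeval shift ((X - C α) ^ n) (displacedAmplitude α D) ≠ 0 := by
  rw [aeval_X_sub_C_pow_displacedAmplitude, annihilation_pow_apply_eq_single hD]
  exact displacedAmplitude_single_zero_ne_zero α (mul_ne_zero (sqrt_factorial_ne_zero n) hn)

theorem eq_smul_of_aeval_X_sub_C_eq_zero {α : ℂ} {s t : ℕ → ℂ} (ht0 : t 0 ≠ 0)
    (hs : aeval shift (X - C α) s = 0) (ht : aeval shift (X - C α) t = 0) :
    s = (s 0 / t 0) • t := by
  have key : ∀ u : ℕ → ℂ, aeval shift (X - C α) u = 0 → ∀ n, u n = α ^ n * u 0 := by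
    intro u hu n
    induction n with
    | zero => simp
    | succ n ih =>
      have h := congrFun hu n
      simp only [map_sub, aeval_X, aeval_C, LinearMap.sub_apply, Pi.sub_apply, shift_apply,
        Module.algebraMap_end_apply, Pi.smul_apply, smul_eq_mul, Pi.zero_apply] at h
      rw [sub_eq_zero.1 h, ih, pow_succ']; ring
  ext n
  rw [Pi.smul_apply, key s hs n, key t ht n, smul_eq_mul]
  field_simp

/-- Every generalized eigenvector of the shift comes from a displaced core vector. -/
theorem exists_displacedAmplitude_eq (α : ℂ) (m : ℕ) : ∀ s : ℕ → ℂ,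
    aeval shift ((X - C α) ^ m) s = 0 →
    ∃ D : CoreVector, (∀ i, m ≤ i → D i = 0) ∧ displacedAmplitude α D = s := by
  induction m with
  | zero =>
    intro s hs
    exact ⟨0, by simp, by simpa using hs.symm⟩
  | succ m ih =>
    intro s hs
    have hvac : aeval shift (X - C α) (displacedAmplitude α (Finsupp.single 0 1)) = 0 := by
      have := aeval_displacedAmplitude_eq_zero α (n := 1) (D := Finsupp.single 0 1)
        fun i hi => by simp [show i ≠ 0 by omega]
      simpa using this
    have hv0 : displacedAmplitude α (Finsupp.single 0 1) 0 ≠ 0 := by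
      rw [displacedAmplitude_vacuum_zero]; exact Complex.exp_ne_zero _
    rw [pow_succ', map_mul, Module.End.mul_apply] at hs
    have h1 := eq_smul_of_aeval_X_sub_C_eq_zero hv0 hs hvac
    set z := aeval shift ((X - C α) ^ m) s 0 / displacedAmplitude α (Finsupp.single 0 1) 0
    -- Scaled so that aᵐ D₀ = z|0⟩; subtracting its amplitudes from s lowers the order from m + 1 to
    -- m.
    set D₀ : CoreVector := Finsupp.single m (z / ((√(m ! : ℝ) : ℝ) : ℂ)) with hD₀
    have hD₀' : ∀ i, m < i → D₀ i = 0 := fun i hi => by simp [hD₀, hi.ne]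
    have h2 : aeval shift ((X - C α) ^ m) (s - displacedAmplitude α D₀) = 0 := by
      rw [map_sub, h1, aeval_X_sub_C_pow_displacedAmplitude, annihilation_pow_apply_eq_single hD₀',
        hD₀, Finsupp.single_eq_same, mul_div_cancel₀ _ (sqrt_factorial_ne_zero m), ← map_smul]
      simp
    obtain ⟨D, hD, hDs⟩ := ih _ h2
    refine ⟨D + D₀, fun i hi => ?_, ?_⟩
    · rw [Finsupp.add_apply, hD i (by omega), hD₀' i (by omega), add_zero]
    · rw [map_add, hDs, sub_add_cancel]

/-! ### The equivalences. -/

theorem iInf_natCast_eq_iff_isLeast {P : ℕ → Prop} {r : ℕ} :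
    (⨅ (k : ℕ) (_ : P k), (k : ℕ∞)) = r ↔ IsLeast {k | P k} r := by
  classical
  constructor
  · intro h
    obtain ⟨k, hk⟩ : ∃ k, P k := by
      by_contra! hne
      simp [hne] at h
    have hfind : IsLeast {k | P k} (Nat.find ⟨k, hk⟩) :=
      ⟨Nat.find_spec ⟨k, hk⟩, fun m hm => Nat.find_min' _ hm⟩
    have h2 : (⨅ (k : ℕ) (_ : P k), (k : ℕ∞)) = (Nat.find ⟨k, hk⟩ : ℕ) :=
      le_antisymm (iInf₂_le _ hfind.1) (le_iInf₂ fun m hm => by exact_mod_cast hfind.2 hm)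
    rw [h] at h2
    rwa [Nat.cast_inj.1 h2]
  · intro h
    exact le_antisymm (iInf₂_le _ h.1) (le_iInf₂ fun m hm => by exact_mod_cast h.2 hm)

theorem approxCoherentRank_eq_iff {ψ : FockSpace} (hψ : ‖ψ‖ = 1) {r : ℕ} :
    approxCoherentRank ψ = r ↔ FollowsRecurrenceOfOrder (rescaledAmplitude ψ) r := by
  rw [approxCoherentRank, iInf_natCast_eq_iff_isLeast]
  have h : {k | ApproximableByCoherent ψ k} = {k | ObeysRecurrence (rescaledAmplitude ψ) k} :=
    Set.ext fun k => ⟨obeysRecurrence_of_approximable hψ, approximable_of_obeysRecurrence hψ⟩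
  rw [h]
  rfl

theorem rescaledAmplitude_sum_displace {k : ℕ} (c α : Fin k → ℂ) (C : Fin k → CoreVector) :
    rescaledAmplitude (∑ j, c j • displace (α j) (C j)) =
      ∑ j, displacedAmplitude (α j) (c j • C j) := by
  simp [displacedAmplitude_apply]

/-- The polynomial ∏ (X - αⱼ)^(nⱼ+1) annihilates the sequence and divides every monic annihilator.
-/
theorem followsRecurrence_of_superposition {ψ : FockSpace} {r : ℕ}
    (h : IsDisplacedCoreSuperposition ψ r) :
    FollowsRecurrenceOfOrder (rescaledAmplitude ψ) r := by
  obtain ⟨k, c, α, D, n, hc, hα, hD, rfl, rfl⟩ := h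
  rw [rescaledAmplitude_sum_displace]
  have hx : ∀ j, aeval shift ((X - C (α j)) ^ (n j + 1))
      (displacedAmplitude (α j) (c j • D j)) = 0 := fun j =>
    aeval_displacedAmplitude_eq_zero _ fun m hm => by
      rw [Finsupp.smul_apply, (hD j).2.2 m (by omega), smul_zero]
  have hx' : ∀ j, aeval shift ((X - C (α j)) ^ n j)
      (displacedAmplitude (α j) (c j • D j)) ≠ 0 := fun j =>
    aeval_displacedAmplitude_ne_zero _ (smul_ne_zero (hc j) (hD j).2.1) fun m hm => by
      rw [Finsupp.smul_apply, (hD j).2.2 m hm, smul_zero]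
  have hmonic : ∀ j ∈ Finset.univ, ((X - C (α j)) ^ (n j + 1)).Monic := fun j _ =>
    (monic_X_sub_C _).pow _
  have hdeg : (∏ j, (X - C (α j)) ^ (n j + 1)).natDegree = ∑ j, (n j + 1) := by
    rw [natDegree_prod_of_monic _ _ hmonic]
    simp
  constructor
  · refine obeysRecurrence_iff_exists_monic.2 ⟨_, monic_prod_of_monic _ _ hmonic, hdeg, ?_⟩
    rw [map_sum]
    refine Finset.sum_eq_zero fun j hj => ?_
    rw [← Finset.prod_erase_mul _ _ hj, map_mul, Module.End.mul_apply, hx j, map_zero]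
  · intro d hd
    obtain ⟨q, hq, rfl, hqs⟩ := obeysRecurrence_iff_exists_monic.1 hd
    rw [← hdeg]
    exact natDegree_le_of_dvd (prod_X_sub_C_pow_dvd hα n hx hx' hq.ne_zero hqs) hq.ne_zero

theorem superposition_of_followsRecurrence {ψ : FockSpace} {r : ℕ}
    (h : FollowsRecurrenceOfOrder (rescaledAmplitude ψ) r) :
    IsDisplacedCoreSuperposition ψ r := by
  classical
  obtain ⟨p, hp, hd, hs⟩ := obeysRecurrence_iff_exists_monic.1 h.1
  set A := p.roots.toFinset with hA
  set e : Fin A.card ≃ A := A.equivFin.symm with he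
  set α : Fin A.card → ℂ := fun j => e j with hαdef
  have hα : Function.Injective α := Subtype.val_injective.comp e.injective
  set m : Fin A.card → ℕ := fun j => p.roots.count (α j) with hm
  have hmpos : ∀ j, 0 < m j := fun j =>
    Multiset.count_pos.2 (Multiset.mem_toFinset.1 (e j).2)
  have hprod : p = ∏ j, (X - C (α j)) ^ m j := by
    conv_lhs => rw [(IsAlgClosed.splits p).eq_prod_roots_of_monic hp]
    rw [Finset.prod_multiset_map_count, ← Finset.prod_coe_sort]
    exact (e.prod_comp fun a : A => (X - C (a : ℂ)) ^ p.roots.count (a : ℂ)).symm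
  have hdeg : ∀ m : Fin A.card → ℕ, (∏ j, (X - C (α j)) ^ m j).natDegree = ∑ j, m j := by
    intro m
    rw [natDegree_prod_of_monic _ _ fun j _ => (monic_X_sub_C _).pow _]
    simp
  rw [hprod] at hs
  obtain ⟨x, hx, hsum⟩ := exists_sum_eq_of_aeval_prod_eq_zero hα m Finset.univ _ hs
  choose D hD hDx using fun j => exists_displacedAmplitude_eq (α j) (m j) (x j) (hx j (by simp))
  -- A vanishing top amplitude would let one factor X - αⱼ be dropped from p, contradicting the
  -- minimality of r.
  have hlead : ∀ j, D j (m j - 1) ≠ 0 := by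
    intro j hzero
    have hlow : aeval shift ((X - C (α j)) ^ (m j - 1)) (x j) = 0 := by
      rw [← hDx j]
      refine aeval_displacedAmplitude_eq_zero _ fun i hi => ?_
      rcases hi.eq_or_lt with rfl | hi
      · exact hzero
      · exact hD j i (by omega)
    set m' := Function.update m j (m j - 1) with hm'
    have hann : aeval shift (∏ l, (X - C (α l)) ^ m' l) (rescaledAmplitude ψ) = 0 := by
      rw [hsum, map_sum]
      refine Finset.sum_eq_zero fun l hl => ?_
      rw [← Finset.prod_erase_mul _ _ hl, map_mul, Module.End.mul_apply]
      have : aeval shift ((X - C (α l)) ^ m' l) (x l) = 0 := by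
        rcases eq_or_ne l j with rfl | hlj
        · rw [hm', Function.update_self]; exact hlow
        · rw [hm', Function.update_of_ne hlj]; exact hx l hl
      rw [this, map_zero]
    have hle : r ≤ ∑ l, m' l := h.2 (obeysRecurrence_iff_exists_monic.2
      ⟨_, monic_prod_of_monic _ _ fun l _ => (monic_X_sub_C _).pow _, hdeg m', hann⟩)
    have hlt : ∑ l, m' l < ∑ l, m l := by
      refine Finset.sum_lt_sum (fun l _ => ?_) ⟨j, Finset.mem_univ j, ?_⟩
      · rcases eq_or_ne l j with rfl | hlj
        · simp [hm']
        · simp [hm', hlj]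
      · simp only [hm', Function.update_self]
        have := hmpos j
        omega
    rw [← hd, hprod, hdeg m] at hle
    omega
  have hnorm : ∀ j, ‖toFock (D j)‖ ≠ 0 := by
    intro j h0
    have h1 : D j = 0 := toFock_injective (by rw [norm_eq_zero.1 h0, map_zero])
    exact hlead j (by rw [h1]; rfl)
  have hnorm' : ∀ j, ((‖toFock (D j)‖ : ℝ) : ℂ) ≠ 0 := fun j =>
    Complex.ofReal_ne_zero.2 (hnorm j)
  -- Each core vector is normalized and its norm becomes the coefficient; a root of multiplicity m
  -- gives highest Fock number m - 1.
  refine ⟨A.card, fun j => ((‖toFock (D j)‖ : ℝ) : ℂ), α,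
    fun j => ((‖toFock (D j)‖ : ℝ) : ℂ)⁻¹ • D j, fun j => m j - 1, hnorm', hα,
    fun j => ⟨?_, ?_, fun i hi => ?_⟩, ?_, ?_⟩
  · rw [map_smul, norm_smul, norm_inv, Complex.norm_real, norm_norm, inv_mul_cancel₀ (hnorm j)]
  · exact smul_ne_zero (inv_ne_zero (hnorm' j)) (hlead j)
  · rw [Finsupp.smul_apply, hD j i (by dsimp only at hi; omega), smul_zero]
  · rw [← hd, hprod, hdeg m]
    exact Finset.sum_congr rfl fun j _ => Nat.sub_add_cancel (hmpos j)
  · apply rescaledAmplitude_injective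
    rw [rescaledAmplitude_sum_displace, hsum]
    refine Finset.sum_congr rfl fun j _ => ?_
    rw [smul_smul, mul_inv_cancel₀ (hnorm' j), one_smul, hDx]

end

end Bosonic

theorem theorem2 (ψ : Bosonic.FockSpace) (hψ : ‖ψ‖ = 1) (r : ℕ) (hr : 0 < r) :
    (Bosonic.approxCoherentRank ψ = (r : ℕ∞) ↔
      Bosonic.FollowsRecurrenceOfOrder
        (fun n : ℕ => ((√(n ! : ℝ) : ℝ) : ℂ) * ψ n) r) ∧
    (Bosonic.approxCoherentRank ψ = (r : ℕ∞) ↔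
      Bosonic.IsDisplacedCoreSuperposition ψ r) :=
  ⟨Bosonic.approxCoherentRank_eq_iff hψ, (Bosonic.approxCoherentRank_eq_iff hψ).trans
    ⟨Bosonic.superposition_of_followsRecurrence, Bosonic.followsRecurrence_of_superposition⟩⟩
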